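/- **Terms.** The terms of the $\lambda\mu$-calculus are built from $\lambda$-variables $x,y,\dots$ and $\mu$-variables $\alpha,\beta,\dots$ by $t ::= x \mid \lambda x\,t \mid (t)t \mid \mu\alpha[\beta]t$, up to renaming of bound variables; $[\beta]t$ is called a named term. A term is closed if it has no free variable of either kind. Write $u[v/{*}\alpha]$ for the result of replacing inductively in $u$ every subterm $[\alpha]w$ by $[\alpha](w)v$. One step of reduction contracts, at any place of a term, a redex of one of the rules - $(C_1)$ $(\lambda x\,u)v\to u[v/x]$; - $(C_2)$ $(\mu\alpha\,u)v\to\mu\alpha\,u[v/{*}\alpha]$; - $(S_1)$ $[\alpha]\mu\beta\,u\to u[\alpha/\beta]$; - $(S_2)$ $\mu\alpha[\alpha]u\to u$ if $\alpha$ is not free in $u$; - $(S_3)$ $\mu\alpha\,u\to\lambda x\,\mu\alpha\,u[x/{*}\alpha]$ ($x$ fresh) if $u$ contains a subterm of the form $[\alpha]\lambda y\,w$. Write $t\to t'$ if $t$ reduces to $t'$ in finitely many (possibly zero) steps; $t$ is normal if it contains no redex. Head normal forms are given inductively: variables; $\lambda x\,u$ with $u$ a head normal form; $(u)v$ with $u$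 a head normal form and $(u)v$ not a redex; $\mu\alpha[\beta]u$ with $u$ a head normal form and neither $\mu\alpha[\beta]u$ nor $[\beta]u$ a redex. Write $t\succ t'$ if $t'$ is obtained from $t$ by a finite (possibly empty) sequence of steps, each of which starts from a term that is not a head normal form and contracts its leftmost redex. **Types.** Fix a language with a constant $0$, a unary function symbol $s$ and possibly other symbols. Types are the formulas built from atomic formulas (with relation variables of all arities) by $\perp,\to$ and first and second order $\forall$. Let $E$ be a set of (universally quantified) equations that is adequate for the integers: for all individual terms $a,b$, $E\not\vdash s(a)=0$, and if $E\vdash s(a)=s(b)$ then $E\vdash a=b$. The judgments $\Gamma\vdash t:A,\Delta$, where the formulas of $\Gamma$ are labelled by distinct $\lambda$-variables and those of $\Delta$ by distinct $\mu$-variables, are derived by the rules: - $\Gamma\vdash x:A,\Delta$ if $x:A$ is in $\Gamma$; - from $\Gamma,x:A\vdash t:B,\Delta$ infer $\Gamma\vdash\lambda x\,t:A\to B,\Delta$; - from $\Gamma\vdash u:A\to B,\Delta$ and $\Gamma\vdash v:A,\Delta$ infer $\Gamma\vdash(u)v:B,\Delta$; - from $\Gamma\vdash t:A,\Delta$ infer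 $\Gamma\vdash t:\forall x\,A,\Delta$ (resp. $\Gamma\vdash t:\forall X\,A,\Delta$) if $x$ (resp. $X$) is not free in $\Gamma,\Delta$; - from $\Gamma\vdash t:\forall x\,A,\Delta$ infer $\Gamma\vdash t:A[a/x],\Delta$ for every individual term $a$; from $\Gamma\vdash t:\forall X\,A,\Delta$ infer $\Gamma\vdash t:A[G/X],\Delta$ for every formula $G$; - from $\Gamma\vdash t:A[a/x],\Delta$ infer $\Gamma\vdash t:A[b/x],\Delta$ if $E\vdash a=b$; - from $\Gamma\vdash t:A,\ \beta:B,\Delta$ infer $\Gamma\vdash\mu\beta[\alpha]t:B,\ \alpha:A,\Delta$ if $\alpha\ne\beta$, and $\Gamma\vdash\mu\beta[\beta]t:B,\Delta$ if $\alpha=\beta$ (and $A=B$). Let $N[a]=\forall X\{X(0)\to(\forall y(X(y)\to X(sy))\to X(a))\}$. A classical integer of value $n$ is a closed term $\theta$ with $\vdash\theta:N[s^n(0)]$. **Statement.** Let $\overline n=\lambda x\lambda f\,(f)^n x$, $\ \overline s=\lambda n\lambda x\lambda f\,(f)((n)x)f$, and $$T_1=\lambda n\,((n)\delta)G,\quad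 \delta=\lambda f\,(f)\overline 0,\quad G=\lambda x\lambda y\,(x)\lambda z\,(y)(\overline s)z;\qquad T_2=\lambda n\lambda f\,(((n)f)F)\overline 0,\quad F=\lambda x\lambda y\,(x)(\overline s)y.$$ If $\theta$ is a normal classical integer of value $n$ (with respect to any adequate $E$), then for $i=1$ and for $i=2$, and for every $\lambda$-variable $f$, $$((T_i)\theta)f\succ(f)(\overline s)^n\overline 0 .$$ Moreover $((T_i)\theta)\lambda x\,x\succ(\lambda x\,x)(\overline s)^n\overline 0\to\overline n$; in particular $((T_i)\theta)\lambda x\,x\to\overline n$. -/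

import Mathlib

universe u v

/-! ### Pure terms -/

/-- Terms of the pure `λμ`-calculus up to renaming of bound variables, with one space of de Bruijn
indices for the `λ`-variables and another one for the `μ`-variables. `mu b t` is `μα[β]t`, where the
index `b` of `β` is read inside the scope of `α`: `b = 0` means `β = α`. -/
inductive LMTerm : Type
  | var (x : ℕ) : LMTerm
  | lam (t : LMTerm) : LMTerm
  | app (t s : LMTerm) : LMTerm
  | mu (b : ℕ) (t : LMTerm) : LMTerm

namespace LMTerm

/-- Extension of a renaming under one binder. -/
def liftRen (r : ℕ → ℕ) : ℕ → ℕ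
  | 0 => 0
  | x + 1 => r x + 1

/-- Renaming of the `λ`-variables. -/
def renLam (r : ℕ → ℕ) : LMTerm → LMTerm
  | var x => var (r x)
  | lam t => lam (t.renLam (liftRen r))
  | app t s => app (t.renLam r) (s.renLam r)
  | mu b t => mu b (t.renLam r)

/-- Renaming of the `μ`-variables. -/
def renMu (r : ℕ → ℕ) : LMTerm → LMTerm
  | var x => var x
  | lam t => lam (t.renMu r)
  | app t s => app (t.renMu r) (s.renMu r)
  | mu b t => mu (liftRen r b) (t.renMu (liftRen r))

/-- The same term, placed under one more `λ`. -/
def shiftLam (t : LMTerm) : LMTerm := t.renLam Nat.succ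

/-- The same term, placed under one more `μ`. -/
def shiftMu (t : LMTerm) : LMTerm := t.renMu Nat.succ

/-- Extension of a substitution under one `λ`. -/
def liftSubst (σ : ℕ → LMTerm) : ℕ → LMTerm
  | 0 => var 0
  | x + 1 => (σ x).shiftLam

/-- Capture-avoiding simultaneous substitution for the `λ`-variables. -/
def subst (σ : ℕ → LMTerm) : LMTerm → LMTerm
  | var x => σ x
  | lam t => lam (t.subst (liftSubst σ))
  | app t s => app (t.subst σ) (s.subst σ)
  | mu b t => mu b (t.subst (fun x => (σ x).shiftMu))

/-- `t[v/x]`, where `x` is the `λ`-variable `0` of `t`, which disappears. -/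
def inst (t v : LMTerm) : LMTerm :=
  t.subst (fun x => match x with
    | 0 => v
    | x + 1 => var x)

/-- `t[v/*α]`, where `α` is the `μ`-variable of index `a` and `v` lives in the same scope as `t`:
every subterm `[α]w` is replaced, inductively, by `[α](w)v`. -/
def muSubst : LMTerm → ℕ → LMTerm → LMTerm
  | var x, _, _ => var x
  | lam t, a, v => lam (t.muSubst a v.shiftLam)
  | app t s, a, v => app (t.muSubst a v) (s.muSubst a v)
  | mu b t, a, v =>
      mu b (if b = a + 1 then app (t.muSubst (a + 1) v.shiftMu) v.shiftMu
        else t.muSubst (a + 1) v.shiftMu)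

/-- `μα u[v/*α]`, where `u` is the named term `[b]t` in the scope of `α` and `v` lives outside of
this scope. -/
def muApp (b : ℕ) (t v : LMTerm) : LMTerm :=
  mu b (if b = 0 then app (t.muSubst 0 v.shiftMu) v.shiftMu else t.muSubst 0 v.shiftMu)

/-- The term is an abstraction `λy w`. -/
def IsLam : LMTerm → Prop
  | lam _ => True
  | _ => False

/-- The term contains a subterm of the form `[α]λy w`, where `α` is the free `μ`-variable `a`. -/
def HasNamedLam (a : ℕ) : LMTerm → Prop
  | var _ => False
  | lam t => t.HasNamedLam a
  | app t s => t.HasNamedLam a ∨ s.HasNamedLam a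
  | mu b t => (b = a + 1 ∧ t.IsLam) ∨ t.HasNamedLam (a + 1)

/-- All free `λ`-variables are `< k` and all free `μ`-variables are `< m`. -/
def ClosedAt (k m : ℕ) : LMTerm → Prop
  | var x => x < k
  | lam t => t.ClosedAt (k + 1) m
  | app t s => t.ClosedAt k m ∧ s.ClosedAt k m
  | mu b t => b < m + 1 ∧ t.ClosedAt k (m + 1)

/-- Closed terms: no free `λ`-variable and no free `μ`-variable. -/
def Closed (t : LMTerm) : Prop := t.ClosedAt 0 0

/-! ### Reduction -/

/-- Contraction of a redex that is a term: the rules `(C₁)`, `(C₂)`, `(S₂)`, `(S₃)`.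
* `(C₁)` `(λx u)v → u[v/x]`;
* `(C₂)` `(μα u)v → μα u[v/*α]`;
* `(S₂)` `μα[α]u → u`, if `α` is not free in `u` (that is, `u` comes from outside of the scope);
* `(S₃)` `μα u → λx μα u[x/*α]`, if `u` contains a subterm of the form `[α]λy w`. -/
inductive Contract : LMTerm → LMTerm → Prop
  | c1 (t v : LMTerm) : Contract (app (lam t) v) (t.inst v)
  | c2 (b : ℕ) (t v : LMTerm) : Contract (app (mu b t) v) (muApp b t v)
  | s2 (t : LMTerm) : Contract (mu 0 t.shiftMu) t
  | s3 (b : ℕ) (t : LMTerm) (h : (b = 0 ∧ t.IsLam) ∨ t.HasNamedLam 0) :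
      Contract (mu b t) (lam (muApp b t.shiftLam (var 0)))

/-- The renaming `[α/β]` of the `μ`-variable `β` of index `0`, which disappears. -/
def renInst (a : ℕ) : ℕ → ℕ
  | 0 => a
  | x + 1 => x

/-- Contraction of a redex that is a named term: `ContractNamed a t b t'` says that
`[a]t → [b]t'` by the rule `(S₁)` `[α]μβ u → u[α/β]`. -/
inductive ContractNamed : ℕ → LMTerm → ℕ → LMTerm → Prop
  | s1 (a b : ℕ) (t : LMTerm) :
      ContractNamed a (mu b t) (renInst a b) (t.renMu (renInst a))

/-- The term is itself a redex. -/
def IsRedex (t : LMTerm) : Prop := ∃ t', Contract t t'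

/-- The named term `[a]t` is itself a redex. -/
def IsNamedRedex (a : ℕ) (t : LMTerm) : Prop := ∃ b t', ContractNamed a t b t'

/-- One step of reduction, at any place of the term. -/
inductive Step : LMTerm → LMTerm → Prop
  | root {t t' : LMTerm} (h : Contract t t') : Step t t'
  | named {a b : ℕ} {t t' : LMTerm} (h : ContractNamed a t b t') : Step (mu a t) (mu b t')
  | lam {t t' : LMTerm} (h : Step t t') : Step (lam t) (lam t')
  | appL {t t' : LMTerm} (s : LMTerm) (h : Step t t') : Step (app t s) (app t' s)
  | appR (t : LMTerm) {s s' : LMTerm} (h : Step s s') : Step (app t s) (app t s')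
  | mu (b : ℕ) {t t' : LMTerm} (h : Step t t') : Step (mu b t) (mu b t')

/-- The reduction `t → t'` of the `λμ`-calculus, in any finite number of steps. -/
def Red : LMTerm → LMTerm → Prop := Relation.ReflTransGen Step

/-- Normal terms: no redex at all. -/
def Normal (t : LMTerm) : Prop := ∀ t', ¬ Step t t'

/-- Head normal forms. -/
inductive Hnf : LMTerm → Prop
  | var (x : ℕ) : Hnf (var x)
  | lam {t : LMTerm} (h : Hnf t) : Hnf (lam t)
  | app {t s : LMTerm} (h : Hnf t) (hr : ¬ IsRedex (app t s)) : Hnf (app t s)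
  | mu {b : ℕ} {t : LMTerm} (h : Hnf t) (hr : ¬ IsRedex (mu b t)) (hn : ¬ IsNamedRedex b t) :
      Hnf (mu b t)

/-- One step of reduction that contracts the leftmost redex. -/
inductive Leftmost : LMTerm → LMTerm → Prop
  | root {t t' : LMTerm} (h : Contract t t') : Leftmost t t'
  | named {a b : ℕ} {t t' : LMTerm} (hr : ¬ IsRedex (mu a t)) (h : ContractNamed a t b t') :
      Leftmost (mu a t) (mu b t')
  | lam {t t' : LMTerm} (h : Leftmost t t') : Leftmost (lam t) (lam t')
  | appL {t t' s : LMTerm} (hr : ¬ IsRedex (app t s)) (h : Leftmost t t') :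
      Leftmost (app t s) (app t' s)
  | appR {t s s' : LMTerm} (hr : ¬ IsRedex (app t s)) (hn : Normal t) (h : Leftmost s s') :
      Leftmost (app t s) (app t s')
  | mu {b : ℕ} {t t' : LMTerm} (hr : ¬ IsRedex (mu b t)) (hn : ¬ IsNamedRedex b t)
      (h : Leftmost t t') : Leftmost (mu b t) (mu b t')

/-- One step of head reduction. -/
def HeadStep (t t' : LMTerm) : Prop := ¬ Hnf t ∧ Leftmost t t'

/-- Head reduction `t ≻ t'`. -/
def HeadRed : LMTerm → LMTerm → Prop := Relation.ReflTransGen HeadStep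

/-! ### Integers and storage operators -/

/-- `(s)ⁿ t`. -/
def iterApp (s : LMTerm) (n : ℕ) (t : LMTerm) : LMTerm := (app s)^[n] t

/-- The Church integer `λx λf (f)ⁿ x`. -/
def church (n : ℕ) : LMTerm := lam (lam (iterApp (var 0) n (var 1)))

/-- The successor `λn λx λf (f)((n)x)f`. -/
def succTerm : LMTerm :=
  lam (lam (lam (app (var 0) (app (app (var 2) (var 1)) (var 0)))))

/-- `λx x`. -/
def idTerm : LMTerm := lam (var 0)

/-- `δ = λf (f)0`. -/
def deltaTerm : LMTerm := lam (app (var 0) (church 0))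

/-- `G = λx λy (x)λz (y)(s)z`. -/
def gTerm : LMTerm :=
  lam (lam (app (var 1) (lam (app (var 1) (app succTerm (var 0))))))

/-- `F = λx λy (x)(s)y`. -/
def fTerm : LMTerm := lam (lam (app (var 1) (app succTerm (var 0))))

/-- `T₁ = λn ((n)δ)G`. -/
def storage1 : LMTerm := lam (app (app (var 0) deltaTerm) gTerm)

/-- `T₂ = λn λf (((n)f)F)0`. -/
def storage2 : LMTerm :=
  lam (lam (app (app (app (var 1) (var 0)) fTerm) (church 0)))

end LMTerm

/-! ### Types: formulas of second order predicate calculus -/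

/-- Formulas of second order predicate calculus over the language `L`, up to renaming of bound
variables. There is one space of de Bruijn indices for the individual variables and, for every
arity `k`, one for the relation variables of arity `k`: `rvar k X ts` is `X(ts)`, `all1` quantifies
over individuals and `all2 k` over relations of arity `k`. -/
inductive SOForm (L : FirstOrder.Language.{u, v}) : Type (max u v)
  | bot : SOForm L
  | rel {k : ℕ} (R : L.Relations k) (ts : Fin k → L.Term ℕ) : SOForm L
  | rvar (k X : ℕ) (ts : Fin k → L.Term ℕ) : SOForm L
  | imp (A B : SOForm L) : SOForm L
  | all1 (A : SOForm L) : SOForm L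
  | all2 (k : ℕ) (A : SOForm L) : SOForm L

namespace SOForm

variable {L : FirstOrder.Language.{u, v}}

/-- Extension of an individual substitution under one individual quantifier. -/
def lift1 (σ : ℕ → L.Term ℕ) : ℕ → L.Term ℕ
  | 0 => FirstOrder.Language.Term.var 0
  | x + 1 => (σ x).relabel Nat.succ

/-- Simultaneous substitution for the individual variables. -/
def subst1 (σ : ℕ → L.Term ℕ) : SOForm L → SOForm L
  | bot => bot
  | rel R ts => rel R (fun i => (ts i).subst σ)
  | rvar k X ts => rvar k X (fun i => (ts i).subst σ)
  | imp A B => imp (A.subst1 σ) (B.subst1 σ)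
  | all1 A => all1 (A.subst1 (lift1 σ))
  | all2 k A => all2 k (A.subst1 σ)

/-- The same formula, placed under one more individual quantifier. -/
def shift1 (A : SOForm L) : SOForm L := A.subst1 (fun x => FirstOrder.Language.Term.var (x + 1))

/-- `A[u/x]`, where `x` is the individual variable `0` of `A`, which disappears. -/
def inst1 (u : L.Term ℕ) (A : SOForm L) : SOForm L :=
  A.subst1 (fun x => match x with
    | 0 => u
    | x + 1 => FirstOrder.Language.Term.var x)

/-- Extension of a renaming of relation variables under a quantifier over relations of
arity `k`. -/
def liftRen2 (k : ℕ) (r : ℕ → ℕ → ℕ) (j : ℕ) : ℕ → ℕ :=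
  if j = k then LMTerm.liftRen (r j) else r j

/-- Renaming of the relation variables: `X` of arity `k` becomes `r k X`. -/
def ren2 (r : ℕ → ℕ → ℕ) : SOForm L → SOForm L
  | bot => bot
  | rel R ts => rel R ts
  | rvar k X ts => rvar k (r k X) ts
  | imp A B => imp (A.ren2 r) (B.ren2 r)
  | all1 A => all1 (A.ren2 r)
  | all2 k A => all2 k (A.ren2 (liftRen2 k r))

/-- The same formula, placed under one more quantifier over relations of arity `k`. -/
def shift2 (k : ℕ) (A : SOForm L) : SOForm L :=
  A.ren2 (fun j X => if j = k then X + 1 else X)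

/-- A formula `G` stands for the relation of arity `k` whose parameters are the individual
variables `0, …, k - 1` of `G` and in which the individual variable `k + x` of `G` denotes the
ambient variable `x`. This is the substitution that applies such a relation to `ts`. -/
def args {k : ℕ} (ts : Fin k → L.Term ℕ) (x : ℕ) : L.Term ℕ :=
  if h : x < k then ts ⟨x, h⟩ else FirstOrder.Language.Term.var (x - k)

/-- The relation variable `X` of arity `k`, as a formula with `k` parameters. -/
def rvarAbs (k X : ℕ) : SOForm L := rvar k X (fun i => FirstOrder.Language.Term.var (i : ℕ))

/-- Simultaneous substitution for the relation variables: `X(ts)`, with `X` of arity `k`, is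
replaced by the formula `τ k X` with parameters `ts`. -/
def subst2 (τ : ℕ → ℕ → SOForm L) : SOForm L → SOForm L
  | bot => bot
  | rel R ts => rel R ts
  | rvar k X ts => (τ k X).subst1 (args ts)
  | imp A B => imp (A.subst2 τ) (B.subst2 τ)
  | all1 A => all1 (A.subst2 (fun k X => (τ k X).subst1
      (fun x => FirstOrder.Language.Term.var (if x < k then x else x + 1))))
  | all2 k A => all2 k (A.subst2 (fun j X =>
      if j = k then
        match X with
        | 0 => rvarAbs j 0
        | X + 1 => (τ j X).shift2 k
      else (τ j X).shift2 k))

/-- `A[G/X]`, where `X` is the relation variable `0` of arity `k` of `A`, which disappears, and `G`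
is a formula with `k` parameters. -/
def inst2 (A : SOForm L) (k : ℕ) (G : SOForm L) : SOForm L :=
  A.subst2 (fun j X =>
    if j = k then
      match X with
      | 0 => G
      | X + 1 => rvarAbs j X
    else rvarAbs j X)

/-- `N[a] = ∀X {X(0), ∀y(X(y) → X(sy)) → X(a)}`. -/
def nat (zero : L.Functions 0) (succ : L.Functions 1) (a : L.Term ℕ) : SOForm L :=
  all2 1 (imp (rvar 1 0 ![FirstOrder.Language.Constants.term zero])
    (imp (all1 (imp (rvar 1 0 ![FirstOrder.Language.Term.var 0])
        (rvar 1 0 ![succ.apply₁ (FirstOrder.Language.Term.var 0)])))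
      (rvar 1 0 ![a])))

end SOForm

/-! ### Equations and typing -/

/-- `EqConseq E a b`: the equation `a = b` is a consequence of the set `E` of (universally
quantified) equations. -/
inductive EqConseq {L : FirstOrder.Language.{u, v}} (E : Set (L.Term ℕ × L.Term ℕ)) :
    L.Term ℕ → L.Term ℕ → Prop
  | ax {a b : L.Term ℕ} (h : (a, b) ∈ E) (σ : ℕ → L.Term ℕ) :
      EqConseq E (a.subst σ) (b.subst σ)
  | refl (a : L.Term ℕ) : EqConseq E a a
  | symm {a b : L.Term ℕ} (h : EqConseq E a b) : EqConseq E b a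
  | trans {a b c : L.Term ℕ} (h : EqConseq E a b) (h' : EqConseq E b c) : EqConseq E a c
  | func {k : ℕ} (f : L.Functions k) {as bs : Fin k → L.Term ℕ}
      (h : ∀ i, EqConseq E (as i) (bs i)) :
      EqConseq E (FirstOrder.Language.Term.func f as) (FirstOrder.Language.Term.func f bs)

/-- `E` is adequate for the type of integers. -/
def Adequate {L : FirstOrder.Language.{u, v}} (zero : L.Functions 0) (succ : L.Functions 1)
    (E : Set (L.Term ℕ × L.Term ℕ)) : Prop :=
  (∀ a : L.Term ℕ, ¬ EqConseq E (succ.apply₁ a) (FirstOrder.Language.Constants.term zero)) ∧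
  (∀ a b : L.Term ℕ, EqConseq E (succ.apply₁ a) (succ.apply₁ b) → EqConseq E a b)

/-- `Typing E Γ t A Δ` is the judgment `Γ ⊢ t : A, Δ` modulo the set of equations `E`. The `i`-th
formulas of `Γ` and `Δ` are labelled by the `λ`-variable and the `μ`-variable of index `i`. In the
introduction rules for `∀` the contexts are shifted, which says that the quantified variable is not
free in them. -/
inductive Typing {L : FirstOrder.Language.{u, v}} (E : Set (L.Term ℕ × L.Term ℕ)) :
    List (SOForm L) → LMTerm → SOForm L → List (SOForm L) → Prop
  | ax {Γ Δ : List (SOForm L)} {x : ℕ} {A : SOForm L} (h : Γ[x]? = some A) :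
      Typing E Γ (LMTerm.var x) A Δ
  | lam {Γ Δ : List (SOForm L)} {t : LMTerm} {A B : SOForm L} (h : Typing E (A :: Γ) t B Δ) :
      Typing E Γ (LMTerm.lam t) (SOForm.imp A B) Δ
  | app {Γ Δ : List (SOForm L)} {t s : LMTerm} {A B : SOForm L}
      (h : Typing E Γ t (SOForm.imp A B) Δ) (h' : Typing E Γ s A Δ) :
      Typing E Γ (LMTerm.app t s) B Δ
  | all1I {Γ Δ : List (SOForm L)} {t : LMTerm} {A : SOForm L}
      (h : Typing E (Γ.map SOForm.shift1) t A (Δ.map SOForm.shift1)) :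
      Typing E Γ t (SOForm.all1 A) Δ
  | all1E {Γ Δ : List (SOForm L)} {t : LMTerm} {A : SOForm L} (a : L.Term ℕ)
      (h : Typing E Γ t (SOForm.all1 A) Δ) : Typing E Γ t (A.inst1 a) Δ
  | all2I {Γ Δ : List (SOForm L)} {t : LMTerm} {k : ℕ} {A : SOForm L}
      (h : Typing E (Γ.map (SOForm.shift2 k)) t A (Δ.map (SOForm.shift2 k))) :
      Typing E Γ t (SOForm.all2 k A) Δ
  | all2E {Γ Δ : List (SOForm L)} {t : LMTerm} {k : ℕ} {A : SOForm L} (G : SOForm L)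
      (h : Typing E Γ t (SOForm.all2 k A) Δ) : Typing E Γ t (A.inst2 k G) Δ
  | eq {Γ Δ : List (SOForm L)} {t : LMTerm} {A : SOForm L} {a b : L.Term ℕ}
      (hab : EqConseq E a b) (h : Typing E Γ t (A.inst1 a) Δ) : Typing E Γ t (A.inst1 b) Δ
  | mu {Γ Δ : List (SOForm L)} {t : LMTerm} {A B : SOForm L} {b : ℕ}
      (hb : (B :: Δ)[b]? = some A) (h : Typing E Γ t A (B :: Δ)) :
      Typing E Γ (LMTerm.mu b t) B Δ

/-- The individual term `sⁿ(0)`. -/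
def numeral {L : FirstOrder.Language.{u, v}} (zero : L.Functions 0) (succ : L.Functions 1) (n : ℕ) :
    L.Term ℕ :=
  (fun a => succ.apply₁ a)^[n] (FirstOrder.Language.Constants.term zero)

/-- `θ` is a classical integer of value `n` (modulo `E`): a closed term of type `N[sⁿ(0)]`. -/
def IsClassicalInteger {L : FirstOrder.Language.{u, v}} (zero : L.Functions 0) (succ : L.Functions 1)
    (E : Set (L.Term ℕ × L.Term ℕ)) (n : ℕ) (θ : LMTerm) : Prop :=
  θ.Closed ∧ Typing E [] θ (SOForm.nat zero succ (numeral zero succ n)) []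

namespace LMTerm

/-! ### Substitution calculus -/

/-! Typing enters once, through realizability. Take a call-by-name machine with two constants
`delta` and `succ`, whose stacks end in a counter. Formulas denote sets of stacks, individuals are
terms modulo `E`, and typed terms realize their types (`Typing.mem_orth`). Let X(d) denote the
counters j with s^j(d) = s^n(0). Then `succ` realizes the successor clause of N, and `delta`
realizes X(0), because adequacy leaves only j = n. So θ, run against `delta`, `succ` and the counter
0, calls `delta` at counter n (`IsClassicalInteger.run`).

Normality turns this run into syntax (`exists_countEval_of_run`). The constants accept so few
arguments that θ must be λxλf u: a μ in front would create an (S₁) or (S₃) redex. For the same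
reason u is a chain of calls of f and of μ's ending in x. `CountEval` is the trace of the counter
along this chain.

Both operators are then handled by one simulation (`headRed_of_countEval`). G and F have the form
λxλy (x)h, and the counter j is represented by an argument k j with h[k j] = k (j+1): for T₁ it is f
wrapped j times in λz (·)(s)z, for T₂ it is (s)^j 0. Head reduction follows the trace: a call of f
turns k j into k (j+1), (C₂) copies the current k j to all places named by the μ, (S₁) merges that μ
with the one already in front, and (S₂) erases the front μ once its name no longer occurs. Every
term so named has received an argument, so it is never an abstraction and (S₃) does not interfere.
Reaching x leaves (d)(k n), which head reduces to (f)(s)^n 0. -/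

theorem liftRen_comp (r s : ℕ → ℕ) (x : ℕ) :
    liftRen r (liftRen s x) = liftRen (fun y => r (s y)) x := by
  cases x <;> rfl

theorem renLam_renLam (r s : ℕ → ℕ) (t : LMTerm) :
    (t.renLam s).renLam r = t.renLam (fun x => r (s x)) := by
  induction t generalizing r s with
  | var x => rfl
  | lam t ih => simp only [renLam, ih, liftRen_comp]
  | app t u iht ihu => simp only [renLam, iht, ihu]
  | mu b t ih => simp only [renLam, ih]

theorem renMu_renMu (r s : ℕ → ℕ) (t : LMTerm) :
    (t.renMu s).renMu r = t.renMu (fun x => r (s x)) := by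
  induction t generalizing r s with
  | var x => rfl
  | lam t ih => simp only [renMu, ih]
  | app t u iht ihu => simp only [renMu, iht, ihu]
  | mu b t ih => simp only [renMu, ih, liftRen_comp]

theorem renLam_renMu (r s : ℕ → ℕ) (t : LMTerm) :
    (t.renMu s).renLam r = (t.renLam r).renMu s := by
  induction t generalizing r s with
  | var x => rfl
  | lam t ih => simp only [renMu, renLam, ih]
  | app t u iht ihu => simp only [renMu, renLam, iht, ihu]
  | mu b t ih => simp only [renMu, renLam, ih]

theorem subst_renLam (σ : ℕ → LMTerm) (r : ℕ → ℕ) (t : LMTerm) :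
    (t.renLam r).subst σ = t.subst (fun x => σ (r x)) := by
  induction t generalizing σ r with
  | var x => rfl
  | lam t ih =>
    simp only [renLam, subst, ih]
    congr 2
    funext x
    cases x <;> rfl
  | app t u iht ihu => simp only [renLam, subst, iht, ihu]
  | mu b t ih => simp only [renLam, subst, ih]

theorem renLam_subst (σ : ℕ → LMTerm) (r : ℕ → ℕ) (t : LMTerm) :
    (t.subst σ).renLam r = t.subst (fun x => (σ x).renLam r) := by
  induction t generalizing σ r with
  | var x => rfl
  | lam t ih =>
    simp only [renLam, subst, ih]
    congr 2
    funext x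
    cases x with
    | zero => rfl
    | succ x => simp only [liftSubst, shiftLam, renLam_renLam, liftRen]
  | app t u iht ihu => simp only [renLam, subst, iht, ihu]
  | mu b t ih => simp only [renLam, subst, ih, shiftMu, renLam_renMu]

theorem renMu_subst (σ : ℕ → LMTerm) (r : ℕ → ℕ) (t : LMTerm) :
    (t.subst σ).renMu r = (t.renMu r).subst (fun x => (σ x).renMu r) := by
  induction t generalizing σ r with
  | var x => rfl
  | lam t ih =>
    simp only [renMu, subst, ih]
    congr 2
    funext x
    cases x with
    | zero => rfl
    | succ x => simp only [liftSubst, shiftLam, renLam_renMu]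
  | app t u iht ihu => simp only [renMu, subst, iht, ihu]
  | mu b t ih => simp only [renMu, subst, ih, shiftMu, renMu_renMu, liftRen]

theorem subst_subst (σ τ : ℕ → LMTerm) (t : LMTerm) :
    (t.subst σ).subst τ = t.subst (fun x => (σ x).subst τ) := by
  induction t generalizing σ τ with
  | var x => rfl
  | lam t ih =>
    simp only [subst, ih]
    congr 2
    funext x
    cases x with
    | zero => rfl
    | succ x => simp only [liftSubst, shiftLam, subst_renLam, renLam_subst]
  | app t u iht ihu => simp only [subst, iht, ihu]
  | mu b t ih => simp only [subst, ih, shiftMu, renMu_subst]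

theorem subst_var (t : LMTerm) : t.subst var = t := by
  induction t with
  | var x => rfl
  | lam t ih =>
    have h : liftSubst var = var := by
      funext x
      cases x <;> rfl
    rw [subst, h, ih]
  | app t u iht ihu => rw [subst, iht, ihu]
  | mu b t ih =>
    have h : (fun x => (var x).shiftMu) = var := rfl
    rw [subst, h, ih]

theorem inst_shiftLam (t v : LMTerm) : t.shiftLam.inst v = t := by
  rw [inst, shiftLam, subst_renLam]
  exact subst_var t

/-! ### Closed terms -/

/-- The `μ`-variable `a` occurs free. -/
def MuFree (a : ℕ) : LMTerm → Prop
  | var _ => False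
  | lam t => t.MuFree a
  | app t s => t.MuFree a ∨ s.MuFree a
  | mu b t => b = a + 1 ∨ t.MuFree (a + 1)

/-- No `μ`-variable occurs free. -/
def MuClosed (t : LMTerm) : Prop := ∀ a, ¬ t.MuFree a

theorem ClosedAt.not_muFree {t : LMTerm} {k m a : ℕ} (h : t.ClosedAt k m) (ha : m ≤ a) :
    ¬ t.MuFree a := by
  induction t generalizing k m a with
  | var x => exact id
  | lam t ih => exact ih (k := k + 1) h ha
  | app t u iht ihu => exact not_or.2 ⟨iht h.1 ha, ihu h.2 ha⟩
  | mu b t ih =>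
    have := h.1
    exact not_or.2 ⟨by omega, ih h.2 (by omega)⟩

theorem Closed.muClosed {t : LMTerm} (h : t.Closed) : t.MuClosed :=
  fun a => ClosedAt.not_muFree h (Nat.zero_le a)

theorem renMu_eq_self {t : LMTerm} {r : ℕ → ℕ} (h : ∀ a, t.MuFree a → r a = a) :
    t.renMu r = t := by
  induction t generalizing r with
  | var x => rfl
  | lam t ih => rw [renMu, ih h]
  | app t u iht ihu =>
    rw [renMu, iht fun a ha => h a (.inl ha), ihu fun a ha => h a (.inr ha)]
  | mu b t ih =>
    rw [renMu, ih]
    · cases b with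
      | zero => rfl
      | succ b => rw [liftRen, h b (.inl rfl)]
    · intro a ha
      cases a with
      | zero => rfl
      | succ a => rw [liftRen, h a (.inr ha)]

theorem MuClosed.renMu_eq {t : LMTerm} (h : t.MuClosed) (r : ℕ → ℕ) : t.renMu r = t :=
  renMu_eq_self fun a ha => (h a ha).elim

theorem MuClosed.shiftMu_eq {t : LMTerm} (h : t.MuClosed) : t.shiftMu = t := h.renMu_eq _

theorem muSubst_eq_self {t : LMTerm} {a : ℕ} (h : ¬ t.MuFree a) (v : LMTerm) :
    t.muSubst a v = t := by
  induction t generalizing a v with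
  | var x => rfl
  | lam t ih => rw [muSubst, ih h]
  | app t u iht ihu =>
    rw [muSubst, iht fun h' => h (.inl h'), ihu fun h' => h (.inr h')]
  | mu b t ih =>
    rw [muSubst, if_neg fun h' => h (.inl h'), ih fun h' => h (.inr h')]

theorem muFree_renLam {t : LMTerm} {a : ℕ} {r : ℕ → ℕ} : (t.renLam r).MuFree a ↔ t.MuFree a := by
  induction t generalizing a r with
  | var x => rfl
  | lam t ih => exact ih
  | app t u iht ihu => exact or_congr iht ihu
  | mu b t ih => exact or_congr Iff.rfl ih

theorem MuClosed.shiftLam {t : LMTerm} (h : t.MuClosed) : t.shiftLam.MuClosed :=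
  fun a ha => h a (muFree_renLam.1 ha)

theorem exists_of_muFree_renMu {t : LMTerm} {b : ℕ} {r : ℕ → ℕ} (h : (t.renMu r).MuFree b) :
    ∃ a, r a = b := by
  induction t generalizing b r with
  | var x => exact h.elim
  | lam t ih => exact ih h
  | app t u iht ihu => exact h.elim iht ihu
  | mu c t ih =>
    rcases h with h | h
    · cases c with
      | zero => cases h
      | succ c => exact ⟨c, Nat.succ.inj h⟩
    · obtain ⟨a, ha⟩ := ih h
      cases a with
      | zero => cases ha
      | succ a => exact ⟨a, Nat.succ.inj ha⟩

theorem not_muFree_shiftMu (t : LMTerm) : ¬ t.shiftMu.MuFree 0 := fun h => by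
  obtain ⟨a, ha⟩ := exists_of_muFree_renMu h
  cases ha

theorem MuFree.subst {t : LMTerm} {a : ℕ} (h : t.MuFree a) (σ : ℕ → LMTerm) :
    (t.subst σ).MuFree a := by
  induction t generalizing a σ with
  | var x => exact h.elim
  | lam t ih => exact ih h _
  | app t u iht ihu => exact h.imp (fun h => iht h σ) (fun h => ihu h σ)
  | mu b t ih => exact h.imp id (fun h => ih h _)

theorem muFree_of_muFree_subst {t : LMTerm} {a : ℕ} {σ : ℕ → LMTerm}
    (hσ : ∀ x, (σ x).MuClosed) (h : (t.subst σ).MuFree a) : t.MuFree a := by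
  induction t generalizing a σ with
  | var x => exact hσ x a h
  | lam t ih =>
    refine ih (fun x => ?_) h
    cases x with
    | zero => exact fun _ => id
    | succ x => exact (hσ x).shiftLam
  | app t u iht ihu => exact h.imp (iht hσ) (ihu hσ)
  | mu b t ih =>
    refine h.imp id (ih fun x => ?_)
    rw [(hσ x).shiftMu_eq]
    exact hσ x

theorem HasNamedLam.muFree {t : LMTerm} {a : ℕ} (h : t.HasNamedLam a) : t.MuFree a := by
  induction t generalizing a with
  | var x => exact h
  | lam t ih => exact ih h
  | app t u iht ihu => exact h.imp iht ihu
  | mu b t ih => exact h.imp And.left ih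

theorem isLam_renLam {t : LMTerm} {r : ℕ → ℕ} : (t.renLam r).IsLam ↔ t.IsLam := by
  cases t <;> rfl

theorem hasNamedLam_renLam {t : LMTerm} {a : ℕ} {r : ℕ → ℕ} :
    (t.renLam r).HasNamedLam a ↔ t.HasNamedLam a := by
  induction t generalizing a r with
  | var x => rfl
  | lam t ih => exact ih
  | app t u iht ihu => exact or_congr iht ihu
  | mu b t ih => exact or_congr (and_congr Iff.rfl isLam_renLam) ih

/-! ### Simultaneous structural substitution -/

/-- `(t)v`, or just `t` if there is no argument. -/
def optApp (t : LMTerm) : Option LMTerm → LMTerm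
  | none => t
  | some v => app t v

/-- Extension of a structural substitution with `μ`-closed arguments under one `μ`. -/
def upMu (e : ℕ → ℕ × Option LMTerm) : ℕ → ℕ × Option LMTerm
  | 0 => (0, none)
  | a + 1 => ((e a).1 + 1, (e a).2)

/-- Simultaneous structural substitution: every subterm `[β]w` becomes `[α](w)v` if
`e β = (α, some v)` and `[α]w` if `e β = (α, none)`. The terms `v` have no free `μ`-variable. -/
def muMap : (ℕ → ℕ × Option LMTerm) → LMTerm → LMTerm
  | _, var x => var x
  | e, lam t => lam (muMap (fun a => ((e a).1, (e a).2.map shiftLam)) t)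
  | e, app t s => app (muMap e t) (muMap e s)
  | e, mu b t => mu (upMu e b).1 (optApp (muMap (upMu e) t) (upMu e b).2)

theorem muMap_congr {t : LMTerm} {e e' : ℕ → ℕ × Option LMTerm}
    (h : ∀ a, t.MuFree a → e a = e' a) : muMap e t = muMap e' t := by
  induction t generalizing e e' with
  | var x => rfl
  | lam t ih =>
    rw [muMap, muMap, ih fun a ha => ?_]
    rw [h a ha]
  | app t u iht ihu =>
    rw [muMap, muMap, iht fun a ha => h a (.inl ha), ihu fun a ha => h a (.inr ha)]
  | mu b t ih =>
    have h' : muMap (upMu e) t = muMap (upMu e') t := ih fun a ha => by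
      cases a with
      | zero => rfl
      | succ a => rw [upMu, upMu, h a (.inr ha)]
    have hb : upMu e b = upMu e' b := by
      cases b with
      | zero => rfl
      | succ b => rw [upMu, upMu, h b (.inl rfl)]
    rw [muMap, muMap, h', hb]

theorem muMap_none (t : LMTerm) : muMap (fun a => (a, none)) t = t := by
  induction t with
  | var x => rfl
  | lam t ih => exact congrArg lam ih
  | app t u iht ihu => rw [muMap, iht, ihu]
  | mu b t ih =>
    have h : upMu (fun a => (a, none)) = fun a => (a, none) := by
      funext a
      cases a <;> rfl
    rw [muMap, h, ih]
    rfl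

theorem MuClosed.muMap_eq {t : LMTerm} (h : t.MuClosed) (e : ℕ → ℕ × Option LMTerm) :
    muMap e t = t :=
  (muMap_congr fun a ha => (h a ha).elim).trans (muMap_none t)

/-- Absorbs the substitution of a (C₂) step into a simultaneous one. The names sent to `a` must not
carry an argument yet, since `muMap` records at most one; the arguments already placed are
`μ`-closed and hence untouched. -/
theorem muSubst_muMap {t : LMTerm} {e e' : ℕ → ℕ × Option LMTerm} {a : ℕ} {v : LMTerm}
    (hv : v.MuClosed) (he : ∀ b w, (e b).2 = some w → w.MuClosed)
    (ha : ∀ b, (e b).1 = a → (e b).2 = none ∧ e' b = (a, some v))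
    (hne : ∀ b, (e b).1 ≠ a → e' b = e b) :
    (muMap e t).muSubst a v = muMap e' t := by
  induction t generalizing e e' a v with
  | var x => rfl
  | lam t ih =>
    rw [muMap, muMap, muSubst, ih hv.shiftLam]
    · intro b w hw
      obtain ⟨w, h, rfl⟩ := Option.map_eq_some_iff.1 hw
      exact (he b w h).shiftLam
    · intro b hb
      rw [(ha b hb).1, (ha b hb).2]
      exact ⟨rfl, rfl⟩
    · intro b hb
      rw [hne b hb]
  | app t u iht ihu => rw [muMap, muMap, muSubst, iht hv he ha hne, ihu hv he ha hne]
  | mu b t ih =>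
    have h : (muMap (upMu e) t).muSubst (a + 1) v = muMap (upMu e') t := by
      refine ih hv ?_ ?_ ?_
      · rintro (_ | b) w hw
        · cases hw
        · exact he b w hw
      · rintro (_ | b) hb
        · cases hb
        · have := ha b (Nat.succ.inj hb)
          exact ⟨this.1, by rw [upMu, this.2]⟩
      · rintro (_ | b) hb
        · rfl
        · rw [upMu, upMu, hne b fun h => hb (congrArg Nat.succ h)]
    rw [muMap, muMap, muSubst, hv.shiftMu_eq]
    cases b with
    | zero => exact congrArg (mu 0) ((if_neg (by simp [upMu])).trans h)
    | succ b =>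
      by_cases hb : (e b).1 = a
      · simp [upMu, (ha b hb).1, (ha b hb).2, hb, optApp, h]
      · cases ho : (e b).2 with
        | none => simp [upMu, hb, hne b hb, ho, optApp, h]
        | some w => simp [upMu, hb, hne b hb, ho, optApp, h, muSubst,
            muSubst_eq_self (he b w ho (a + 1))]

/-- Absorbs the renaming of an (S₁) step: only target names change, the arguments being `μ`-closed.
-/
theorem renMu_muMap {t : LMTerm} {e : ℕ → ℕ × Option LMTerm} {r : ℕ → ℕ}
    (he : ∀ b w, (e b).2 = some w → w.MuClosed) :
    (muMap e t).renMu r = muMap (fun b => (r (e b).1, (e b).2)) t := by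
  induction t generalizing e r with
  | var x => rfl
  | lam t ih =>
    rw [muMap, muMap, renMu, ih]
    intro b w hw
    obtain ⟨w, h, rfl⟩ := Option.map_eq_some_iff.1 hw
    exact (he b w h).shiftLam
  | app t u iht ihu => rw [muMap, muMap, renMu, iht he, ihu he]
  | mu b t ih =>
    have h : (muMap (upMu e) t).renMu (liftRen r) =
        muMap (upMu fun b => (r (e b).1, (e b).2)) t := by
      rw [ih]
      · congr 1
        funext b
        cases b <;> rfl
      · rintro (_ | b) w hw
        · cases hw
        · exact he b w hw
    rw [muMap, muMap, renMu]
    cases b with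
    | zero => exact congrArg (mu 0) h
    | succ b =>
      cases ho : (e b).2 with
      | none => simp [upMu, ho, optApp, h, liftRen]
      | some w => simp [upMu, ho, optApp, h, liftRen, renMu, (he b w ho).renMu_eq]

theorem MuFree.muMap {t : LMTerm} {a : ℕ} (h : t.MuFree a) (e : ℕ → ℕ × Option LMTerm) :
    (muMap e t).MuFree (e a).1 := by
  induction t generalizing a e with
  | var x => exact h.elim
  | lam t ih => exact ih h fun a => ((e a).1, (e a).2.map LMTerm.shiftLam)
  | app t u iht ihu => exact h.imp (fun h => iht h e) (fun h => ihu h e)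
  | mu b t ih =>
    rcases h with rfl | h
    · exact .inl rfl
    · refine .inr ?_
      have := ih h (upMu e)
      cases (upMu e b).2 with
      | none => exact this
      | some w => exact .inl this

/-- Everything named `a` has become an application, hence not an abstraction. This is what excludes
(S₃) at the front `μ` during the simulation. -/
theorem not_hasNamedLam_muMap {t : LMTerm} {a : ℕ} {e : ℕ → ℕ × Option LMTerm}
    (he : ∀ b w, (e b).2 = some w → w.MuClosed)
    (ha : ∀ b, (e b).1 = a → (e b).2.isSome) : ¬ (muMap e t).HasNamedLam a := by
  induction t generalizing a e with
  | var x => exact id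
  | lam t ih =>
    refine ih (e := fun a => ((e a).1, (e a).2.map LMTerm.shiftLam)) ?_ ?_
    · intro b w hw
      obtain ⟨w, h, rfl⟩ := Option.map_eq_some_iff.1 hw
      exact (he b w h).shiftLam
    · intro b hb
      simpa using ha b hb
  | app t u iht ihu => exact not_or.2 ⟨iht he ha, ihu he ha⟩
  | mu b t ih =>
    have h : ¬ (muMap (upMu e) t).HasNamedLam (a + 1) := by
      refine ih ?_ ?_
      · rintro (_ | b) w hw
        · cases hw
        · exact he b w hw
      · rintro (_ | b) hb
        · cases hb
        · exact ha b (Nat.succ.inj hb)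
    refine not_or.2 ⟨?_, ?_⟩
    · rintro ⟨hb, hl⟩
      cases b with
      | zero => cases hb
      | succ b =>
        obtain ⟨w, hw⟩ := Option.isSome_iff_exists.1 (ha b (Nat.succ.inj hb))
        rw [upMu, hw] at hl
        exact hl
    · cases b with
      | zero => exact h
      | succ b =>
        cases ho : (e b).2 with
        | none => rwa [upMu, ho]
        | some w =>
          rw [upMu, ho]
          exact not_or.2 ⟨h, fun h' => he b w ho _ h'.muFree⟩

/-! ### Head steps -/

theorem Hnf.not_isRedex {t : LMTerm} (h : Hnf t) : ¬ IsRedex t := by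
  cases h with
  | var x => rintro ⟨_, ⟨⟩⟩
  | lam h => rintro ⟨_, ⟨⟩⟩
  | app h hr => exact hr
  | mu h hr hn => exact hr

/-- A head normal form is never itself a redex, so contraction at the root is always a head step. -/
theorem Contract.headStep {t t' : LMTerm} (h : Contract t t') : HeadStep t t' :=
  ⟨fun h' => h'.not_isRedex ⟨t', h⟩, .root h⟩

theorem headStep_beta {t v t' : LMTerm} (h : t.inst v = t') : HeadStep (app (lam t) v) t' :=
  h ▸ (Contract.c1 t v).headStep

theorem not_isRedex_app_app (t s u : LMTerm) : ¬ IsRedex (app (app t s) u) := by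
  rintro ⟨_, ⟨⟩⟩

theorem HeadStep.app_app {t s t' : LMTerm} (h : HeadStep (app t s) t') (u : LMTerm) :
    HeadStep (app (app t s) u) (app t' u) :=
  ⟨fun h' => by cases h' with | app h' _ => exact h.1 h', .appL (not_isRedex_app_app _ _ _) h.2⟩

theorem not_isRedex_mu {b : ℕ} {t : LMTerm} (h : t.MuFree 0) (hl : ¬ t.IsLam)
    (hn : ¬ t.HasNamedLam 0) : ¬ IsRedex (mu b t) := by
  rintro ⟨_, h'⟩
  cases h' with
  | s2 => exact not_muFree_shiftMu _ h
  | s3 _ _ h' => exact h'.elim (fun h' => hl h'.2) hn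

/-- Three redexes could take precedence at the front: (S₂) fails by `hf`, (S₃) by `hn`, and (S₁)
because the body is an application. -/
theorem HeadStep.mu_app {t s t' : LMTerm} (h : HeadStep (app t s) t') (hf : (app t s).MuFree 0)
    (hn : ¬ (app t s).HasNamedLam 0) : HeadStep (mu 0 (app t s)) (mu 0 t') := by
  refine ⟨fun h' => ?_, .mu (not_isRedex_mu hf id hn) ?_ h.2⟩
  · cases h' with | mu h' _ _ => exact h.1 h'
  · rintro ⟨_, _, ⟨⟩⟩

theorem headStep_mu_mu {b : ℕ} {t : LMTerm} (hf : (mu b t).MuFree 0)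
    (hn : ¬ (mu b t).HasNamedLam 0) :
    HeadStep (mu 0 (mu b t)) (mu (renInst 0 b) (t.renMu (renInst 0))) := by
  refine ⟨fun h' => ?_, .named (not_isRedex_mu hf id hn) (.s1 0 b t)⟩
  cases h' with | mu _ _ h' => exact h' ⟨_, _, .s1 0 b t⟩

theorem Leftmost.step {t t' : LMTerm} (h : Leftmost t t') : Step t t' := by
  induction h with
  | root h => exact .root h
  | named _ h => exact .named h
  | lam _ ih => exact .lam ih
  | appL _ _ ih => exact .appL _ ih
  | appR _ _ _ ih => exact .appR _ ih
  | mu _ _ _ ih => exact .mu _ ih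

theorem HeadRed.red {t t' : LMTerm} (h : HeadRed t t') : Red t t' :=
  Relation.ReflTransGen.mono (fun _ _ h => h.2.step) _ _ h

end LMTerm

/-- Extension of a sequence by a new first entry. -/
def seqCons {α : Type*} (a : α) (e : ℕ → α) : ℕ → α
  | 0 => a
  | x + 1 => e x

namespace LMTerm

/-! ### Evaluation of the body of a classical integer -/

/-- `CountEval t e j n`: if `λxλf t` is applied to `x` and `f`, then, starting with the counter `j`,
the head of `t` increases the counter whenever `f` is called, the `μ`-variables save and restore the
counter, and the counter is `n` when `x` is called. -/
inductive CountEval : LMTerm → (ℕ → ℕ) → ℕ → ℕ → Prop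
  | zero (e : ℕ → ℕ) (n : ℕ) : CountEval (var 1) e n n
  | succ {t : LMTerm} {e : ℕ → ℕ} {j n : ℕ} (h : CountEval t e (j + 1) n) :
      CountEval (app (var 0) t) e j n
  | mu {t : LMTerm} {e : ℕ → ℕ} {j n : ℕ} (b : ℕ)
      (h : CountEval t (seqCons j e) (seqCons j e b) n) : CountEval (mu b t) e j n

/-- With `headStep_continue`, one call of f: λxλy (x)h first takes the rest `t` of the chain, then
the current continuation `v`, and resumes `t` on h[v]. The hypothesis `hh` expresses that y is the
only free `λ`-variable of h. -/
theorem headStep_callcc {t h : LMTerm} (hh : ∀ σ, h.subst (liftSubst σ) = h) :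
    HeadStep (app (lam (lam (app (var 1) h))) t) (lam (app t.shiftLam h)) := by
  refine headStep_beta ?_
  rw [inst, subst, subst, hh]
  rfl

theorem headStep_continue (t h v : LMTerm) :
    HeadStep (app (lam (app t.shiftLam h)) v) (app t (h.inst v)) := by
  refine headStep_beta ?_
  rw [inst, subst]
  exact congrArg (app · _) (inst_shiftLam t v)

/-- The structural substitution of the continuation `k (e a)` for every `μ`-variable `a`; the
resulting named terms get the name `m`. -/
def contMap (m : ℕ) (k : ℕ → LMTerm) (e : ℕ → ℕ) (a : ℕ) : ℕ × Option LMTerm := (m, some (k (e a)))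

theorem exists_muFree_mu {t : LMTerm} {b : ℕ} (h : ¬ (mu b t).MuClosed) :
    ∃ a, (mu b t).MuFree a := by
  by_contra! h'
  exact h h'

/-- The arguments of `λxλf t` are `d` and `λxλy (x)h`, followed by the continuation `k 0`. -/
theorem headRed_of_countEval {d h goal : LMTerm} {k : ℕ → LMTerm} {σ : ℕ → LMTerm}
    (hh : ∀ σ, h.subst (liftSubst σ) = h) (hk : ∀ j, h.inst (k j) = k (j + 1))
    (hkc : ∀ j, (k j).MuClosed) (h0 : σ 0 = lam (lam (app (var 1) h))) (h1 : σ 1 = d)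
    (hσ : ∀ x, (σ x).MuClosed) {t : LMTerm} {e : ℕ → ℕ} {j n : ℕ} (ht : CountEval t e j n)
    (hgoal : HeadRed (app d (k n)) goal) :
    (t.MuClosed → HeadRed (app (t.subst σ) (k j)) goal) ∧
      HeadRed (mu 0 (app (muMap (contMap 0 k e) (t.subst σ)) (k j))) goal := by
  have hcc : ∀ m e b w, (contMap m k e b).2 = some w → w.MuClosed := by
    rintro m e b w hw
    cases hw
    exact hkc _
  have hsub : ∀ {t : LMTerm}, t.MuClosed → (t.subst σ).MuClosed := fun ht a ha =>
    ht a (muFree_of_muFree_subst hσ ha)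
  have hshift : (fun x => (σ x).shiftMu) = σ := funext fun x => (hσ x).shiftMu_eq
  have hGc : (lam (lam (app (var 1) h))).MuClosed := h0 ▸ hσ 0
  have hhc : h.MuClosed := fun a ha => hGc a (.inr ha)
  -- If `t` is `μ`-closed, the map does nothing and (S₂) removes the front `μ`, so the second claim
  -- follows from the first. It then remains to treat the bare term when `t` is closed and the term
  -- under `μ` when it is not.
  have key : ∀ {t : LMTerm} {e : ℕ → ℕ} {j : ℕ},
      (t.MuClosed → HeadRed (app (t.subst σ) (k j)) goal) →
      (¬ t.MuClosed → HeadRed (mu 0 (app (muMap (contMap 0 k e) (t.subst σ)) (k j))) goal) →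
      (t.MuClosed → HeadRed (app (t.subst σ) (k j)) goal) ∧
        HeadRed (mu 0 (app (muMap (contMap 0 k e) (t.subst σ)) (k j))) goal := by
    intro t e j hclosed hopen
    refine ⟨hclosed, ?_⟩
    by_cases htc : t.MuClosed
    · rw [(hsub htc).muMap_eq]
      have hs : (app (t.subst σ) (k j)).shiftMu = app (t.subst σ) (k j) :=
        congrArg₂ app (hsub htc).shiftMu_eq (hkc j).shiftMu_eq
      refine .head ?_ (hclosed htc)
      have := (Contract.s2 (app (t.subst σ) (k j))).headStep
      rwa [hs] at this
    · exact hopen htc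
  induction ht with
  | zero e n =>
    refine key (fun _ => ?_) (fun h => (h fun _ => id).elim)
    rwa [subst, h1]
  | @succ t e j n ht ih =>
    have ih := ih hgoal
    refine key (fun hc => ?_) (fun hc => ?_)
    · have := ih.1 fun a ha => hc a (.inr ha)
      rw [← hk] at this
      rw [subst, subst, h0]
      exact .head ((headStep_callcc hh).app_app _) (.head (headStep_continue _ _ _) this)
    · have := ih.2
      rw [← hk] at this
      rw [subst, subst, h0, muMap, hGc.muMap_eq]
      obtain ⟨a, ha⟩ : ∃ a, t.MuFree a := by
        by_contra! h'
        exact hc fun a ha => ha.elim id (h' a)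
      have hf : (muMap (contMap 0 k e) (t.subst σ)).MuFree 0 :=
        MuFree.muMap (ha.subst σ) (contMap 0 k e)
      have hn : ¬ (muMap (contMap 0 k e) (t.subst σ)).HasNamedLam 0 :=
        not_hasNamedLam_muMap (hcc 0 e) fun _ _ => rfl
      refine .head (((headStep_callcc hh).app_app _).mu_app (.inl (.inr hf)) ?_)
        (.head ((headStep_continue _ _ _).mu_app (.inl (.inl (muFree_renLam.2 hf))) ?_) this)
      · rintro ((h' | h') | h')
        · exact hGc _ (HasNamedLam.muFree h')
        · exact hn h'
        · exact hkc _ _ h'.muFree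
      · rintro ((h' | h') | h')
        · exact hn (hasNamedLam_renLam.1 h')
        · exact hhc _ h'.muFree
        · exact hkc _ _ h'.muFree
  | @mu t e j n b ht ih =>
    have ih := (ih hgoal).2
    refine key (fun hc => ?_) (fun hc => ?_)
    · cases b with
      | succ b => exact (hc b (.inl rfl)).elim
      | zero =>
        refine .head (Contract.c2 _ _ _).headStep ?_
        -- The bound name is the only free name of the body, so the values of both maps at other
        -- names are irrelevant.
        have hs : (t.subst σ).muSubst 0 (k j) =
            muMap (contMap 0 k (seqCons j e)) (t.subst σ) := by
          rw [← muMap_none (t.subst σ), muSubst_muMap (hkc j)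
            (e' := fun a => if a = 0 then (0, some (k j)) else (a, none)), muMap_none]
          · refine muMap_congr fun a ha => ?_
            cases a with
            | zero => rfl
            | succ a => exact (hc a (.inr (muFree_of_muFree_subst hσ ha))).elim
          · rintro b w ⟨⟩
          · rintro b rfl
            exact ⟨rfl, rfl⟩
          · intro b hb
            exact if_neg hb
        rw [hshift, muApp, if_pos rfl, (hkc j).shiftMu_eq, hs]
        exact ih
    -- (C₂) under the front `μ`: inside the new `μ`, its own name 0 receives `k j`, while every
    -- outer name, already merged into the front one, now reads 1 and keeps its saved continuation.
    · have hstep : Contract (app (muMap (contMap 0 k e) ((mu b t).subst σ)) (k j))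
          (mu (seqCons 0 (fun _ => 1) b)
            (app (muMap (fun a => (seqCons 0 (fun _ => 1) a, some (k (seqCons j e a))))
              (t.subst σ)) (k (seqCons j e b)))) := by
        have hs : (muMap (upMu (contMap 0 k e)) (t.subst σ)).muSubst 0 (k j) =
            muMap (fun a => (seqCons 0 (fun _ => 1) a, some (k (seqCons j e a))))
              (t.subst σ) := by
          refine muSubst_muMap (hkc j) ?_ ?_ ?_
          · rintro (_ | b) w hw
            · cases hw
            · exact hcc 0 e b w hw
          · rintro (_ | b) hb
            · exact ⟨rfl, rfl⟩
            · cases hb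
          · rintro (_ | b) hb
            · exact (hb rfl).elim
            · rfl
        rw [subst, hshift, muMap]
        convert Contract.c2 (upMu (contMap 0 k e) b).1
          (optApp (muMap (upMu (contMap 0 k e)) (t.subst σ)) (upMu (contMap 0 k e) b).2) (k j)
          using 1
        cases b with
        | zero => simp [muApp, upMu, optApp, seqCons, (hkc j).shiftMu_eq, hs]
        | succ b =>
          simp [muApp, upMu, optApp, seqCons, contMap, (hkc j).shiftMu_eq, muSubst, hs,
            muSubst_eq_self (hkc (e b) 0)]
      obtain ⟨a, ha⟩ := exists_muFree_mu hc
      have hf : (app (muMap (contMap 0 k e) ((mu b t).subst σ)) (k j)).MuFree 0 :=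
        .inl (MuFree.muMap (ha.subst σ) (contMap 0 k e))
      have hn : ¬ (app (muMap (contMap 0 k e) ((mu b t).subst σ)) (k j)).HasNamedLam 0 :=
        not_or.2 ⟨not_hasNamedLam_muMap (hcc 0 e) fun _ _ => rfl, fun h' => hkc _ _ h'.muFree⟩
      refine .head (hstep.headStep.mu_app hf hn) (.head (headStep_mu_mu ?_ ?_) ?_)
      · rcases ha with rfl | ha
        · exact .inl rfl
        · exact .inr (.inl (MuFree.muMap (ha.subst σ)
            (fun a => (seqCons 0 (fun _ => 1) a, some (k (seqCons j e a))))))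
      · rintro (⟨_, h'⟩ | h' | h')
        · exact h'
        · refine not_hasNamedLam_muMap ?_ (fun _ _ => rfl) h'
          rintro b w ⟨⟩
          exact hkc _
        · exact hkc _ _ h'.muFree
      -- (S₁) identifies the two names 0 and 1, restoring the shape with a single front `μ`.
      · have hr : ∀ a, renInst 0 (seqCons 0 (fun _ => 1) a) = 0 := by
          rintro (_ | a) <;> rfl
        rw [renMu, (hkc _).renMu_eq, renMu_muMap, hr]
        · simp only [hr]
          exact ih
        · rintro b w ⟨⟩
          exact hkc _

end LMTerm

namespace LMTerm

/-! ### An abstract machine -/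

/-- Closures and stacks of the abstract machine. There are two constants `delta` and `succ`; a stack
is a list of closures on top of a counter. -/
inductive Obj : Type
  | delta : Obj
  | succ : Obj
  | clo (t : LMTerm) (ρ e : ℕ → Obj) : Obj
  | num (j : ℕ) : Obj
  | cons (c π : Obj) : Obj

/-- `Run n c π`: the machine started with the closure `c` and the stack `π` calls `delta` on the
counter `n`. -/
inductive Run (n : ℕ) : Obj → Obj → Prop
  | delta : Run n .delta (.num n)
  | succ {c : Obj} {j : ℕ} (h : Run n c (.num (j + 1))) : Run n .succ (.cons c (.num j))
  | var {x : ℕ} {ρ e : ℕ → Obj} {π : Obj} (h : Run n (ρ x) π) : Run n (.clo (var x) ρ e) π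
  | lam {t : LMTerm} {ρ e : ℕ → Obj} {c π : Obj} (h : Run n (.clo t (seqCons c ρ) e) π) :
      Run n (.clo (lam t) ρ e) (.cons c π)
  | app {t s : LMTerm} {ρ e : ℕ → Obj} {π : Obj}
      (h : Run n (.clo t ρ e) (.cons (.clo s ρ e) π)) : Run n (.clo (app t s) ρ e) π
  | mu {b : ℕ} {t : LMTerm} {ρ e : ℕ → Obj} {π : Obj}
      (h : Run n (.clo t ρ (seqCons π e)) (seqCons π e b)) : Run n (.clo (mu b t) ρ e) π

theorem Normal.of_lam {t : LMTerm} (h : (lam t).Normal) : t.Normal := fun _ h' => h _ (.lam h')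

theorem Normal.of_app_left {t s : LMTerm} (h : (app t s).Normal) : t.Normal :=
  fun _ h' => h _ (.appL _ h')

theorem Normal.of_app_right {t s : LMTerm} (h : (app t s).Normal) : s.Normal :=
  fun _ h' => h _ (.appR _ h')

theorem Normal.of_mu {b : ℕ} {t : LMTerm} (h : (mu b t).Normal) : t.Normal :=
  fun _ h' => h _ (.mu _ h')

theorem not_normal_app_lam (t s : LMTerm) : ¬ (app (lam t) s).Normal :=
  fun h => h _ (.root (.c1 t s))

theorem not_normal_app_mu (b : ℕ) (t s : LMTerm) : ¬ (app (mu b t) s).Normal :=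
  fun h => h _ (.root (.c2 b t s))

theorem not_run_cons {n : ℕ} {c d d' π : Obj} (hc : c = .delta ∨ c = .succ) :
    ¬ Run n c (.cons d (.cons d' π)) := by
  rcases hc with rfl | rfl <;> rintro ⟨⟩

/-- By normality the head is a variable, that is, a constant; it would meet at least two closures on
the stack, whereas `delta` accepts none and `succ` exactly one. -/
theorem not_run_app_cons {n : ℕ} {t s : LMTerm} {ρ e : ℕ → Obj} {c π : Obj}
    (hρ : ∀ x, ρ x = .delta ∨ ρ x = .succ) (ht : (app t s).Normal) :
    ¬ Run n (.clo (app t s) ρ e) (.cons c π) := by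
  induction t generalizing s c π with
  | var x =>
    intro h
    cases h with
    | app h => cases h with
      | var h => exact not_run_cons (hρ x) h
  | lam t => exact (not_normal_app_lam _ _ ht).elim
  | app t u iht _ =>
    intro h
    cases h with
    | app h => exact iht ht.of_app_left h
  | mu b t => exact (not_normal_app_mu _ _ _ ht).elim

/-- Environment of the body of a classical integer `λxλf t`. -/
def bodyEnv : ℕ → Obj := seqCons .succ (seqCons .delta fun _ => .delta)

theorem bodyEnv_eq (x : ℕ) : bodyEnv x = .delta ∨ bodyEnv x = .succ := by
  rcases x with _ | _ | x
  exacts [.inr rfl, .inl rfl, .inl rfl]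

/-- The stack is a bare counter throughout: an abstraction is stuck on it, and an application can
only be f with one argument. All saved stacks are counters as well, so the machine environment for
`μ` is a sequence of numbers. -/
theorem countEval_of_run {n : ℕ} {t : LMTerm} {m : ℕ} {e : ℕ → ℕ} {j : ℕ} (ht : t.Normal)
    (hc : t.ClosedAt 2 m) (h : Run n (.clo t bodyEnv fun a => .num (e a)) (.num j)) :
    CountEval t e j n := by
  induction t generalizing m e j with
  | var x =>
    obtain _ | _ | ⟨h⟩ := h
    rcases x with _ | _ | x
    · cases h
    · cases h
      exact .zero _ _
    -- Beyond x and f the environment has the default `delta`, which would accept the counter;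
    -- closedness is needed here.
    · exact absurd hc (by simp [ClosedAt])
  | lam t => cases h
  | app t s _ ihs =>
    obtain _ | _ | _ | _ | ⟨h⟩ := h
    cases t with
    | var x =>
      obtain _ | _ | ⟨h⟩ := h
      rcases x with _ | _ | x
      · cases h with | succ h => exact .succ (ihs ht.of_app_right hc.2 h)
      · cases h
      · cases h
    | lam t => exact (not_normal_app_lam _ _ ht).elim
    | app t u => exact (not_run_app_cons bodyEnv_eq ht.of_app_left h).elim
    | mu b t => exact (not_normal_app_mu _ _ _ ht).elim
  | mu b t ih =>
    obtain _ | _ | _ | _ | _ | ⟨h⟩ := h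
    have he : seqCons (.num j) (fun a => .num (e a)) = fun a => Obj.num (seqCons j e a) := by
      funext a
      cases a <;> rfl
    rw [he] at h
    exact .mu b (ih ht.of_mu hc.2 h)

/-- A variable denotes `delta`, which refuses a closure, and an application has too many arguments.
A front `μ` names itself, as no other name is free, so its body faces the same stack; the two
further shapes of that body, an abstraction and a `μ`, give an (S₃) and an (S₁) redex. -/
theorem exists_lam_of_run {n k : ℕ} {t : LMTerm} {ρ e : ℕ → Obj} {c π : Obj}
    (hρ : ∀ x, ρ x = .delta) (ht : t.Normal) (hc : t.ClosedAt k 0)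
    (h : Run n (.clo t ρ e) (.cons c π)) :
    ∃ t', t = lam t' ∧ Run n (.clo t' (seqCons c ρ) e) π := by
  have hvar : ∀ {x : ℕ} {e : ℕ → Obj} {c π : Obj}, ¬ Run n (.clo (var x) ρ e) (.cons c π) := by
    intro x e c π h
    cases h with
    | var h =>
      rw [hρ] at h
      cases h
  cases t with
  | var x => exact (hvar h).elim
  | lam t => cases h with | lam h => exact ⟨t, rfl, h⟩
  | app t s => exact (not_run_app_cons (fun x => .inl (hρ x)) ht h).elim
  | mu b t =>
    obtain rfl : b = 0 := Nat.lt_one_iff.1 hc.1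
    cases h with
    | mu h =>
      cases t with
      | var x => exact (hvar h).elim
      | lam t => exact (ht _ (.root (.s3 0 (lam t) (.inl ⟨rfl, trivial⟩)))).elim
      | app t s => exact (not_run_app_cons (fun x => .inl (hρ x)) ht.of_mu h).elim
      | mu b t => exact (ht _ (.named (.s1 0 b t))).elim

/-- A closed normal term that counts to `n` on the machine is `λxλf t`, and `t` counts to `n`. -/
theorem exists_countEval_of_run {n : ℕ} {t : LMTerm} (ht : t.Normal) (hc : t.Closed)
    (h : Run n (.clo t (fun _ => .delta) fun _ => .num 0)
      (.cons .delta (.cons .succ (.num 0)))) :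
    ∃ u, t = lam (lam u) ∧ CountEval u (fun _ => 0) 0 n := by
  obtain ⟨t, rfl, h'⟩ := exists_lam_of_run (fun _ => rfl) ht hc h
  obtain ⟨u, rfl, h''⟩ := exists_lam_of_run (k := 1) (by rintro (_ | x) <;> rfl) ht.of_lam hc h'
  exact ⟨u, rfl, countEval_of_run ht.of_lam.of_lam hc h''⟩

end LMTerm

/-! ### Realizability -/

section Realizability

open FirstOrder Language

variable {L : FirstOrder.Language.{u, v}}

/-! ### Individuals: terms modulo the equations -/

namespace EqConseq

variable {E : Set (L.Term ℕ × L.Term ℕ)}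

theorem subst_subst {α β γ : Type*} (t : L.Term α) (σ : α → L.Term β) (τ : β → L.Term γ) :
    (t.subst σ).subst τ = t.subst fun x => (σ x).subst τ := by
  induction t with
  | var x => rfl
  | func f ts ih => exact congrArg (Term.func f) (funext ih)

theorem subst {a b : L.Term ℕ} (h : EqConseq E a b) (σ : ℕ → L.Term ℕ) :
    EqConseq E (a.subst σ) (b.subst σ) := by
  induction h with
  | ax h τ =>
    rw [subst_subst, subst_subst]
    exact .ax h _
  | refl a => exact .refl _
  | symm _ ih => exact .symm ih
  | trans _ _ ih ih' => exact .trans ih ih'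
  | func f _ ih => exact .func f ih

variable (E)

/-- Individual terms modulo provable equality. -/
def setoid : Setoid (L.Term ℕ) where
  r := EqConseq E
  iseqv := ⟨.refl, .symm, .trans⟩

/-- The individuals: individual terms modulo provable equality. -/
abbrev Individual : Type _ := Quotient (setoid E)

/-- The functions act on individuals. -/
noncomputable instance : L.Structure (Individual E) where
  funMap f as := Quotient.mk (setoid E) (Term.func f fun i => (as i).out)
  RelMap _ _ := False

/-- The chosen representatives do not matter, by the congruence rule of `EqConseq`. -/
theorem funMap_mk {k : ℕ} (f : L.Functions k) (ts : Fin k → L.Term ℕ) :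
    Structure.funMap f (fun i => (Quotient.mk (setoid E) (ts i) : Individual E)) =
      Quotient.mk (setoid E) (Term.func f ts) :=
  Quotient.sound (.func f fun i => Quotient.mk_out (s := setoid E) (ts i))

theorem realize_eq_mk (v : ℕ → Individual E) (t : L.Term ℕ) :
    t.realize v = Quotient.mk (setoid E) (t.subst fun x => (v x).out) := by
  induction t with
  | var x => exact ((v x).out_eq).symm
  | func f ts ih =>
    rw [Term.realize]
    simp only [ih]
    exact funMap_mk E f _

variable {E}

theorem realize_eq {a b : L.Term ℕ} (h : EqConseq E a b) (v : ℕ → Individual E) :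
    a.realize v = b.realize v := by
  rw [realize_eq_mk, realize_eq_mk]
  exact Quotient.sound (h.subst _)

end EqConseq

/-! ### Falsity values and their behaviour under substitution -/

namespace SOForm

open LMTerm

variable {D : Type*} [L.Structure D]

/-- Values of the relation variables: for every arity, relations on `D` with values in the sets of
stacks. -/
abbrev RelVal (D : Type*) : Type _ := (k : ℕ) → ℕ → (Fin k → D) → Set Obj

/-- A new value for the relation variable `0` of arity `k`. -/
def RelVal.cons {k : ℕ} (P : (Fin k → D) → Set Obj) (V : RelVal D) : RelVal D := fun j X =>
  if h : j = k then
    match X with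
    | 0 => fun ds => P fun i => ds (Fin.cast h.symm i)
    | X + 1 => V j X
  else V j X

/-- The closures that are orthogonal to all stacks of a set. -/
def orth (n : ℕ) (S : Set Obj) : Set Obj := {c | ∀ π ∈ S, Run n c π}

/-- The falsity value of a formula: a set of stacks. -/
def falsity (n : ℕ) : SOForm L → (ℕ → D) → RelVal D → Set Obj
  -- No typing rule is specific to `bot` or to relation symbols, so a constant value is harmless for
  -- them.
  | bot, _, _ => ∅
  | rel _ _, _, _ => ∅
  | rvar k X ts, v, V => V k X fun i => (ts i).realize v
  | imp A B, v, V => {π | ∃ c ∈ orth n (falsity n A v V), ∃ π' ∈ falsity n B v V, π = .cons c π'}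
  | all1 A, v, V => {π | ∃ d, π ∈ falsity n A (seqCons d v) V}
  | all2 k A, v, V => {π | ∃ P : (Fin k → D) → Set Obj, π ∈ falsity n A v (V.cons P)}

variable {n : ℕ}

theorem falsity_subst1 (A : SOForm L) (σ : ℕ → L.Term ℕ) (v : ℕ → D) (V : RelVal D) :
    falsity n (A.subst1 σ) v V = falsity n A (fun x => (σ x).realize v) V := by
  induction A generalizing σ v V with
  | bot => rfl
  | rel R ts => rfl
  | rvar k X ts => simp only [subst1, falsity, Term.realize_subst]
  | imp A B ihA ihB => simp only [subst1, falsity, ihA, ihB]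
  | all1 A ih =>
    simp only [subst1, falsity, ih]
    congr! 6 with d
    funext x
    cases x with
    | zero => rfl
    | succ x => simp only [lift1, Term.realize_relabel, seqCons]; rfl
  | all2 k A ih => simp only [subst1, falsity, ih]

theorem falsity_shift1 (A : SOForm L) (d : D) (v : ℕ → D) (V : RelVal D) :
    falsity n A.shift1 (seqCons d v) V = falsity n A v V :=
  falsity_subst1 A _ _ V

theorem falsity_inst1 (A : SOForm L) (a : L.Term ℕ) (v : ℕ → D) (V : RelVal D) :
    falsity n (A.inst1 a) v V = falsity n A (seqCons (a.realize v) v) V := by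
  rw [inst1, falsity_subst1]
  congr 1
  funext x
  cases x <;> rfl

theorem falsity_ren2 (A : SOForm L) (r : ℕ → ℕ → ℕ) (v : ℕ → D) (V : RelVal D) :
    falsity n (A.ren2 r) v V = falsity n A v fun k X => V k (r k X) := by
  induction A generalizing r v V with
  | bot => rfl
  | rel R ts => rfl
  | rvar k X ts => rfl
  | imp A B ihA ihB => simp only [ren2, falsity, ihA, ihB]
  | all1 A ih => simp only [ren2, falsity, ih]
  | all2 k A ih =>
    simp only [ren2, falsity, ih]
    congr! 6 with P
    funext j X
    by_cases h : j = k
    · subst h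
      cases X <;> simp [RelVal.cons, liftRen2, LMTerm.liftRen]
    · simp [RelVal.cons, liftRen2, h]

theorem falsity_shift2 (A : SOForm L) {k : ℕ} (P : (Fin k → D) → Set Obj) (v : ℕ → D)
    (V : RelVal D) : falsity n (A.shift2 k) v (V.cons P) = falsity n A v V := by
  rw [shift2, falsity_ren2]
  congr 1
  funext j X
  by_cases h : j = k
  · subst h
    simp [RelVal.cons]
  · simp [RelVal.cons, h]

/-- Values of the individual variables of a formula with `k` parameters. -/
def argVal {k : ℕ} (ds : Fin k → D) (v : ℕ → D) (x : ℕ) : D :=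
  if h : x < k then ds ⟨x, h⟩ else v (x - k)

theorem realize_args {k : ℕ} (ts : Fin k → L.Term ℕ) (v : ℕ → D) (x : ℕ) :
    (args ts x).realize v = argVal (fun i => (ts i).realize v) v x := by
  unfold args argVal
  split <;> rfl

theorem falsity_rvarAbs (k X : ℕ) (ds : Fin k → D) (v : ℕ → D) (V : RelVal D) :
    falsity n (rvarAbs k X : SOForm L) (argVal ds v) V = V k X ds := by
  simp [rvarAbs, falsity, argVal]

theorem falsity_subst2 (A : SOForm L) (τ : ℕ → ℕ → SOForm L) (v : ℕ → D) (V : RelVal D) :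
    falsity n (A.subst2 τ) v V =
      falsity n A v fun k X ds => falsity n (τ k X) (argVal ds v) V := by
  induction A generalizing τ v V with
  | bot => rfl
  | rel R ts => rfl
  | rvar k X ts => simp only [subst2, falsity, falsity_subst1, realize_args]
  | imp A B ihA ihB => simp only [subst2, falsity, ihA, ihB]
  | all1 A ih =>
    simp only [subst2, falsity, ih, falsity_subst1]
    congr! 6 with d
    funext k X ds
    congr 1
    funext x
    -- Indices below `k` are the parameters; the newly quantified individual sits at position `k`
    -- and has to be skipped.
    by_cases h : x < k
    · simp [argVal, h]
    · have hx : x + 1 - k = (x - k) + 1 := by omega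
      have h' : ¬ x + 1 < k := by omega
      simp [argVal, h, h', hx, seqCons]
  | all2 k A ih =>
    simp only [subst2, falsity, ih]
    congr! 6 with P
    funext j X ds
    by_cases h : j = k
    · subst h
      cases X with
      | zero => simp [falsity_rvarAbs, RelVal.cons]
      | succ X => simp [falsity_shift2, RelVal.cons]
    · simp [h, falsity_shift2, RelVal.cons]

/-- Comprehension: relation variables range over all stack-valued relations, among them the one
defined by `G`. This validates second order elimination. -/
theorem falsity_inst2 (A : SOForm L) (k : ℕ) (G : SOForm L) (v : ℕ → D) (V : RelVal D) :
    falsity n (A.inst2 k G) v V =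
      falsity n A v (V.cons fun ds : Fin k → D => falsity n G (argVal ds v) V) := by
  rw [inst2, falsity_subst2]
  congr 1
  funext j X ds
  by_cases h : j = k
  · subst h
    cases X <;> simp [falsity_rvarAbs, RelVal.cons]
  · simp [h, falsity_rvarAbs, RelVal.cons]

end SOForm

/-! ### Soundness of typing for the machine -/

open LMTerm SOForm

/-- Typed terms realize their types. -/
theorem Typing.mem_orth {E : Set (L.Term ℕ × L.Term ℕ)} {Γ Δ : List (SOForm L)} {t : LMTerm}
    {A : SOForm L} (h : Typing E Γ t A Δ) (n : ℕ) (v : ℕ → EqConseq.Individual E)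
    (V : RelVal (EqConseq.Individual E)) {ρ e : ℕ → Obj}
    (hρ : ∀ x B, Γ[x]? = some B → ρ x ∈ orth n (falsity n B v V))
    (he : ∀ a B, Δ[a]? = some B → e a ∈ falsity n B v V) :
    .clo t ρ e ∈ orth n (falsity n A v V) := by
  induction h generalizing v V ρ e with
  | ax h => exact fun π hπ => .var (hρ _ _ h π hπ)
  | lam _ ih =>
    rintro _ ⟨c, hc, π, hπ, rfl⟩
    refine .lam (ih v V ?_ he π hπ)
    rintro (_ | x) B hB
    · cases hB
      exact hc
    · exact hρ x B hB
  | app _ _ ih ih' => exact fun π hπ => .app (ih v V hρ he _ ⟨_, ih' v V hρ he, π, hπ, rfl⟩)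
  | all1I _ ih =>
    rintro π ⟨d, hπ⟩
    refine ih (seqCons d v) V ?_ ?_ π hπ
    · intro x B hB
      obtain ⟨B, hB', rfl⟩ := Option.map_eq_some_iff.1 (List.getElem?_map ▸ hB)
      rw [falsity_shift1]
      exact hρ x B hB'
    · intro x B hB
      obtain ⟨B, hB', rfl⟩ := Option.map_eq_some_iff.1 (List.getElem?_map ▸ hB)
      rw [falsity_shift1]
      exact he x B hB'
  | all1E a _ ih =>
    rw [falsity_inst1]
    exact fun π hπ => ih v V hρ he π ⟨_, hπ⟩
  | all2I _ ih =>
    rintro π ⟨P, hπ⟩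
    refine ih v (V.cons P) ?_ ?_ π hπ
    · intro x B hB
      obtain ⟨B, hB', rfl⟩ := Option.map_eq_some_iff.1 (List.getElem?_map ▸ hB)
      rw [falsity_shift2]
      exact hρ x B hB'
    · intro x B hB
      obtain ⟨B, hB', rfl⟩ := Option.map_eq_some_iff.1 (List.getElem?_map ▸ hB)
      rw [falsity_shift2]
      exact he x B hB'
  | all2E G _ ih =>
    rw [falsity_inst2]
    exact fun π hπ => ih v V hρ he π ⟨_, hπ⟩
  | eq hab _ ih =>
    -- Provably equal terms denote the same individual in the quotient.
    rw [falsity_inst1, ← EqConseq.realize_eq hab, ← falsity_inst1]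
    exact ih v V hρ he
  | @mu Γ Δ t A B b hb _ ih =>
    intro π hπ
    -- The current stack is saved under the new name, so every name, old or new, can be resumed at
    -- its own formula.
    have he' : ∀ a C, (B :: Δ)[a]? = some C → seqCons π e a ∈ falsity n C v V := by
      rintro (_ | a) C hC
      · cases hC
        exact hπ
      · exact he a C hC
    exact .mu (ih v V hρ he' _ (he' _ _ hb))

/-! ### Numerals and the run of a classical integer -/

variable {zero : L.Functions 0} {succ : L.Functions 1} {E : Set (L.Term ℕ × L.Term ℕ)}

theorem Adequate.eq_of_numeral (hE : Adequate zero succ E) {m n : ℕ}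
    (h : EqConseq E (numeral zero succ m) (numeral zero succ n)) : m = n := by
  induction m generalizing n with
  | zero =>
    cases n with
    | zero => rfl
    | succ n =>
      rw [numeral, numeral, Function.iterate_succ_apply'] at h
      exact (hE.1 _ h.symm).elim
  | succ m ih =>
    cases n with
    | zero =>
      rw [numeral, numeral, Function.iterate_succ_apply'] at h
      exact (hE.1 _ h).elim
    | succ n =>
      rw [numeral, numeral, Function.iterate_succ_apply', Function.iterate_succ_apply'] at h
      exact congrArg Nat.succ (ih (hE.2 _ _ h))

/-- The successor of individuals. -/
noncomputable def succInd (succ : L.Functions 1) (d : EqConseq.Individual E) :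
    EqConseq.Individual E :=
  Structure.funMap succ ![d]

theorem succInd_iterate (n : ℕ) :
    (succInd succ)^[n] (Structure.funMap zero ![] : EqConseq.Individual E) =
      Quotient.mk (EqConseq.setoid E) (numeral zero succ n) := by
  induction n with
  | zero =>
    rw [numeral, Function.iterate_zero_apply, Function.iterate_zero_apply]
    refine Eq.trans (congrArg _ (Subsingleton.elim _ _)) (EqConseq.funMap_mk E zero _)
  | succ n ih =>
    rw [numeral, Function.iterate_succ_apply', Function.iterate_succ_apply', ih]
    refine Eq.trans (congrArg (Structure.funMap succ) ?_) (EqConseq.funMap_mk E succ ![_])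
    funext i
    fin_cases i
    rfl

theorem realize_numeral (v : ℕ → EqConseq.Individual E) (n : ℕ) :
    (numeral zero succ n).realize v = (succInd succ)^[n] (Structure.funMap zero ![]) := by
  induction n with
  | zero => exact congrArg (Structure.funMap zero) (Subsingleton.elim _ _)
  | succ n ih =>
    rw [numeral, Function.iterate_succ_apply', Function.iterate_succ_apply', ← ih]
    exact Term.realize_functions_apply₁

/-- Instantiate X by `P`: a counter j is allowed against X(d) when j successors lead from d to n.
The counter 0 is allowed at s^n(0), passing from X(sy) to X(y) raises the counter by one, and at 0
adequacy forces j = n. -/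
theorem IsClassicalInteger.run (hE : Adequate zero succ E) {n : ℕ} {θ : LMTerm}
    (hθ : IsClassicalInteger zero succ E n θ) (ρ e : ℕ → Obj) :
    Run n (.clo θ ρ e) (.cons .delta (.cons .succ (.num 0))) := by
  let z : EqConseq.Individual E := Structure.funMap zero ![]
  let P : (Fin 1 → EqConseq.Individual E) → Set Obj := fun ds =>
    {π | ∃ j, π = .num j ∧ (succInd succ)^[j] (ds 0) = (succInd succ)^[n] z}
  -- The valuations are arbitrary, as the type is closed; the contexts are empty, so any
  -- environments will do.
  refine hθ.2.mem_orth n (fun _ => z) (fun _ _ _ => ∅) (ρ := ρ) (e := e) (by simp) (by simp) _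
    ⟨P, .delta, ?_, _, ⟨.succ, ?_, .num 0, ⟨0, rfl, ?_⟩, rfl⟩, rfl⟩
  · rintro _ ⟨j, rfl, hj⟩
    have hz : (Constants.term zero : L.Term ℕ).realize (fun _ => z) = z :=
      realize_numeral (zero := zero) (succ := succ) _ 0
    have hj' : (succInd succ)^[j] z = (succInd succ)^[n] z := by
      rw [← hj]
      exact congrArg _ hz.symm
    rw [succInd_iterate, succInd_iterate] at hj'
    rw [hE.eq_of_numeral (Quotient.exact hj')]
    exact .delta
  · rintro _ ⟨d, c, hc, _, ⟨j, rfl, hj⟩, rfl⟩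
    refine .succ (hc _ ⟨j + 1, rfl, ?_⟩)
    rw [← hj, Function.iterate_succ_apply]
    exact congrArg _ Term.realize_functions_apply₁.symm
  · exact realize_numeral (fun _ => z) n

end Realizability

namespace LMTerm

/-! ### Church integers -/

theorem Red.lam {t t' : LMTerm} (h : Red t t') : Red (lam t) (lam t') :=
  h.lift _ fun _ _ => .lam

theorem Red.app_left {t t' : LMTerm} (h : Red t t') (s : LMTerm) : Red (app t s) (app t' s) :=
  h.lift (app · s) fun _ _ => .appL s

theorem Red.app_right (t : LMTerm) {s s' : LMTerm} (h : Red s s') : Red (app t s) (app t s') :=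
  h.lift _ fun _ _ => .appR t

theorem red_beta {t v t' : LMTerm} (h : t.inst v = t') : Red (app (LMTerm.lam t) v) t' :=
  .single (h ▸ .root (.c1 t v))

theorem subst_iterApp (s t : LMTerm) (σ : ℕ → LMTerm) (n : ℕ) :
    (iterApp s n t).subst σ = iterApp (s.subst σ) n (t.subst σ) := by
  induction n with
  | zero => rfl
  | succ n ih =>
    rw [iterApp, iterApp, Function.iterate_succ_apply', Function.iterate_succ_apply', subst]
    exact congrArg _ ih

theorem renLam_iterApp (s t : LMTerm) (r : ℕ → ℕ) (n : ℕ) :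
    (iterApp s n t).renLam r = iterApp (s.renLam r) n (t.renLam r) := by
  induction n with
  | zero => rfl
  | succ n ih =>
    rw [iterApp, iterApp, Function.iterate_succ_apply', Function.iterate_succ_apply', renLam]
    exact congrArg _ ih

theorem renLam_church (r : ℕ → ℕ) (n : ℕ) : (church n).renLam r = church n := by
  rw [church, renLam, renLam, renLam_iterApp]
  rfl

theorem red_succTerm_church (n : ℕ) : Red (app succTerm (church n)) (church (n + 1)) := by
  have h1 : Red (app succTerm (church n))
      (lam (lam (app (var 0) (app (app (church n) (var 1)) (var 0))))) := by
    refine red_beta ?_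
    simp [inst, subst, liftSubst, shiftLam, renLam, renLam_church]
  have h2 : Red (app (church n) (var 1)) (lam (iterApp (var 0) n (var 2))) := by
    refine red_beta ?_
    rw [inst, subst, subst_iterApp]
    rfl
  have h3 : Red (app (lam (iterApp (var 0) n (var 2))) (var 0)) (iterApp (var 0) n (var 1)) := by
    refine red_beta ?_
    rw [inst, subst_iterApp]
    rfl
  refine h1.trans (Red.lam (Red.lam ?_))
  rw [iterApp, Function.iterate_succ_apply']
  exact Red.app_right _ ((h2.app_left _).trans h3)

theorem red_iterApp_succTerm (n : ℕ) : Red (iterApp succTerm n (church 0)) (church n) := by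
  induction n with
  | zero => exact .refl
  | succ n ih =>
    rw [iterApp, Function.iterate_succ_apply']
    exact (Red.app_right _ ih).trans (red_succTerm_church n)

theorem red_idTerm (t : LMTerm) : Red (app idTerm t) t := red_beta rfl

/-! ### The storage operators -/

theorem muClosed_church_zero : (church 0).MuClosed :=
  Closed.muClosed (by simp [Closed, ClosedAt, church, iterApp])

theorem muClosed_succTerm : succTerm.MuClosed :=
  Closed.muClosed (by simp [Closed, ClosedAt, succTerm])

/-- The continuation `λz (k)(s)z`. -/
def contSucc (k : LMTerm) : LMTerm := lam (app k.shiftLam (app succTerm (var 0)))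

theorem MuClosed.contSucc {k : LMTerm} (h : k.MuClosed) : k.contSucc.MuClosed := by
  rintro a (h' | h' | h')
  · exact h.shiftLam a h'
  · exact muClosed_succTerm a h'
  · exact h'

/-- The substitution of `g` and `d` for the variables of the body of a classical integer. -/
def bodySubst (g d : LMTerm) : ℕ → LMTerm := seqCons g (seqCons d var)

theorem muClosed_bodySubst {g d : LMTerm} (hg : g.MuClosed) (hd : d.MuClosed) (x : ℕ) :
    (bodySubst g d x).MuClosed := by
  rcases x with _ | _ | x
  exacts [hg, hd, fun _ => id]

/-- Head reduction of a classical integer applied to `d`, to `λxλy (x)h` and to `k 0`. -/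
theorem headRed_integer {d h goal t : LMTerm} {k : ℕ → LMTerm} {n : ℕ}
    (hh : ∀ σ, h.subst (liftSubst σ) = h) (hk : ∀ j, h.inst (k j) = k (j + 1))
    (hkc : ∀ j, (k j).MuClosed) (hhc : h.MuClosed) (hd : d.MuClosed)
    (ht : CountEval t (fun _ => 0) 0 n) (htc : t.MuClosed)
    (hgoal : HeadRed (app d (k n)) goal) :
    HeadRed (app (app (app (lam (lam t)) d) (lam (lam (app (var 1) h)))) (k 0)) goal := by
  have hg : (lam (lam (app (var 1) h))).MuClosed := fun a ha => ha.elim id (hhc a)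
  have h1 := (headRed_of_countEval hh hk hkc (σ := bodySubst (lam (lam (app (var 1) h))) d) rfl rfl
    (muClosed_bodySubst hg hd) ht hgoal).1 htc
  refine .head (((headStep_beta rfl).app_app _).app_app _) (.head ((headStep_beta ?_).app_app _) h1)
  -- The two successive β-substitutions, by `d` for x and then by λxλy (x)h for f, compose to
  -- `bodySubst`.
  rw [inst, subst_subst]
  congr 1
  funext x
  rcases x with _ | _ | x
  · rfl
  · exact inst_shiftLam d _
  · rfl

/-- Each unfolding of λz (k)(s)z puts one successor on the argument, so the count passes from the
continuation to the integer; generality in `i` makes the induction go through. -/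
theorem headRed_contSucc (f : LMTerm) (i j : ℕ) :
    HeadRed (app (contSucc^[j] f) (iterApp succTerm i (church 0)))
      (app f (iterApp succTerm (i + j) (church 0))) := by
  induction j generalizing i with
  | zero => exact .refl
  | succ j ih =>
    rw [Function.iterate_succ_apply']
    have := ih (i + 1)
    rw [iterApp, Function.iterate_succ_apply'] at this
    rw [← Nat.add_assoc, Nat.add_right_comm]
    refine .head (headStep_beta ?_) this
    rw [inst, subst]
    exact congrArg₂ app (inst_shiftLam _ _) rfl

end LMTerm

/-! ### Conclusion for both operators -/

open LMTerm

/-- Two instances of `headRed_integer`. For T₁ the count is stored in the continuation, with `d` =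
δ, and δ finally feeds 0 to it. For T₂ it is stored in the accumulated integer, with `d` = f, and
nothing remains to be done at the end. -/
theorem headRed_storage {T t f : LMTerm} {n : ℕ} (hT : T = storage1 ∨ T = storage2)
    (ht : CountEval t (fun _ => 0) 0 n) (hc : (lam (lam t)).Closed) (hf : f.MuClosed) :
    HeadRed (app (app T (lam (lam t))) f) (app f (iterApp succTerm n (church 0))) := by
  have htc : t.MuClosed := hc.muClosed
  have hs : succTerm.MuClosed := muClosed_succTerm
  rcases hT with rfl | rfl
  · refine .head (.app_app (headStep_beta rfl) _) ?_
    refine headRed_integer (k := fun j => contSucc^[j] f)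
      (h := lam (app (var 1) (app succTerm (var 0)))) ?_ ?_ ?_ ?_ ?_ ht htc ?_
    · intro σ
      rfl
    · intro j
      rw [Function.iterate_succ_apply']
      rfl
    · intro j
      induction j with
      | zero => exact hf
      | succ j ih =>
        rw [Function.iterate_succ_apply']
        exact ih.contSucc
    · rintro a (h | h | h)
      exacts [h, hs a h, h]
    · rintro a (h | h)
      exacts [h, muClosed_church_zero a h]
    · have := headRed_contSucc f 0 n
      rw [Nat.zero_add] at this
      exact .head (headStep_beta rfl) this
  · have hstep : HeadStep (app storage2 (lam (lam t)))
        (lam (app (app (app (lam (lam t)).shiftLam (var 0)) fTerm) (church 0))) :=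
      headStep_beta rfl
    refine .head (hstep.app_app f) (.head (headStep_beta ?_)
      (headRed_integer (d := f) (k := fun j => iterApp succTerm j (church 0))
        (h := app succTerm (var 0)) ?_ ?_ ?_ ?_ hf ht htc .refl))
    · have h := inst_shiftLam (lam (lam t)) f
      rw [inst] at h
      rw [inst, subst, subst, subst, h]
      rfl
    · intro σ
      rfl
    · intro j
      simp only [iterApp, Function.iterate_succ_apply']
      rfl
    · intro j
      induction j with
      | zero => exact muClosed_church_zero
      | succ j ih =>
        simp only [iterApp, Function.iterate_succ_apply'] at ih ⊢
        rintro a (h | h)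
        exacts [hs a h, ih a h]
    · rintro a (h | h)
      exacts [hs a h, h]

theorem mainTheorem8 {L : FirstOrder.Language.{u, v}} (zero : L.Functions 0)
    (succ : L.Functions 1) (E : Set (L.Term ℕ × L.Term ℕ)) (hE : Adequate zero succ E)
    (n : ℕ) (θ : LMTerm) (hθ : IsClassicalInteger zero succ E n θ) (hnormal : θ.Normal)
    (T : LMTerm) (hT : T = LMTerm.storage1 ∨ T = LMTerm.storage2) :
    (∀ f : ℕ, LMTerm.HeadRed (.app (.app T θ) (.var f))
      (.app (.var f) (LMTerm.iterApp LMTerm.succTerm n (LMTerm.church 0)))) ∧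
    LMTerm.HeadRed (.app (.app T θ) LMTerm.idTerm)
      (.app LMTerm.idTerm (LMTerm.iterApp LMTerm.succTerm n (LMTerm.church 0))) ∧
    LMTerm.Red (.app LMTerm.idTerm (LMTerm.iterApp LMTerm.succTerm n (LMTerm.church 0)))
      (LMTerm.church n) ∧
    LMTerm.Red (.app (.app T θ) LMTerm.idTerm) (LMTerm.church n) := by
  obtain ⟨t, rfl, ht⟩ := exists_countEval_of_run hnormal hθ.1 (hθ.run hE _ _)
  have hid : LMTerm.idTerm.MuClosed := fun _ => id
  refine ⟨fun f => headRed_storage hT ht hθ.1 fun _ => id, headRed_storage hT ht hθ.1 hid,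
    (red_idTerm _).trans (red_iterApp_succTerm n), ?_⟩
  exact (headRed_storage hT ht hθ.1 hid).red.trans ((red_idTerm _).trans (red_iterApp_succTerm n))
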